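/- Let $\mathbb{F}=\mathbb{R}$ or $\mathbb{C}$. A random matrix $\Omega\in\mathbb{F}^{m\times n}$ has the *Strong $(\varepsilon,\delta)$-JLM property* if for every unit vector $x\in\mathbb{F}^n$ and every integer $t$ with $2\le t\le\log(1/\delta)$, $$\bigl\|\,\|\Omega x\|_2^2-1\,\bigr\|_{L^t}\le\frac{\varepsilon}{e}\sqrt{\frac{t}{\log(1/\delta)}}\qquad\text{and}\qquad \mathbb{E}\bigl[\|\Omega x\|_2^2\bigr]=1,$$ where $\|Z\|_{L^t}=(\mathbb{E}|Z|^t)^{1/t}$; the second condition is required for every unit vector $x$, whether or not such an integer $t$ exists. **Lemma.** Let $P,m,n$ be integers with $P\ge 1$ and $m,n\ge 0$, and let $\varepsilon,\delta>0$. Let $\Omega_1,\dots,\Omega_P$ be independent and identically distributed realizations of a random matrix in $\mathbb{F}^{m\times n}$ that has the Strong $\bigl(\tfrac{\sqrt{P}\,\varepsilon}{4e^2},\delta\bigr)$-JLM property. Then the random matrix $$\Omega=\frac{1}{\sqrt{P}}\begin{bmatrix}\Omega_1\\ \vdots\\ \Omega_P\end{bmatrix}\in\mathbb{F}^{Pm\times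 n}$$ has the Strong $(\varepsilon,\delta)$-JLM property. -/

import Mathlib

/-!
Write `Z i` for the distortions `‖A i x‖² - 1`, which are independent and centred. Expanding
`E |S + Z|^p` for independent `S` and centred `Z`, the term linear in `Z` vanishes, so each new
summand multiplies the bound `R^p` by a factor that involves only its moments of order at least two.
If those moments grow like `(K √k)^k`, the choice `R = 4 e K √(N t)` makes every factor at most
`exp (t / N)`; the `N` factors together contribute `e^t`, and taking `t`-th roots bounds the
`L^t` norm of the sum by `4 e² K √(N t)`, which is where the constant `4 e²` comes from.
-/

open MeasureTheory ProbabilityTheory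
open scoped Matrix

/-- Matrices carry the product (entrywise) measurable structure. -/
instance matrixMeasurableSpace {𝕜 : Type*} [MeasurableSpace 𝕜] {m n : ℕ} :
    MeasurableSpace (Matrix (Fin m) (Fin n) 𝕜) :=
  inferInstanceAs (MeasurableSpace (Fin m → Fin n → 𝕜))

/-- The random matrix `A` (defined on the probability space `(Ω, μ)`, with values in the
`m × n` matrices over `𝕜 = ℝ` or `ℂ`) has the Strong `(ε, δ)`-JLM property: for every unit vector
`x` and every integer `2 ≤ t ≤ log (1/δ)`, the `L^t(μ)` norm of `‖A x‖₂² - 1` is at most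
`(ε/e) √(t / log (1/δ))`, and `𝔼 ‖A x‖₂² = 1`. -/
structure StrongJLM {𝕜 : Type*} [RCLike 𝕜] {m n : ℕ} {Ω : Type*} [MeasurableSpace Ω]
    (A : Ω → Matrix (Fin m) (Fin n) 𝕜) (μ : Measure Ω) (ε δ : ℝ) : Prop where
  aemeasurable : AEMeasurable A μ
  moment : ∀ x : EuclideanSpace 𝕜 (Fin n), ‖x‖ = 1 →
    ∀ t : ℕ, 2 ≤ t → (t : ℝ) ≤ Real.log (1 / δ) →
      eLpNorm (fun ω => ‖WithLp.toLp 2 (A ω *ᵥ x.ofLp)‖ ^ 2 - 1) t μ ≤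
        ENNReal.ofReal (ε / Real.exp 1 * Real.sqrt (t / Real.log (1 / δ)))
  expectation : ∀ x : EuclideanSpace 𝕜 (Fin n), ‖x‖ = 1 →
    ∫ ω, ‖WithLp.toLp 2 (A ω *ᵥ x.ofLp)‖ ^ 2 ∂μ = 1

/-- The vertical stack `[A 0; A 1; …; A (P-1)]` of `P` matrices of size `m × n`: row `i * m + k` of
the stack is row `k` of the block `A i`. -/
def vstack {𝕜 : Type*} {P m n : ℕ} (A : Fin P → Matrix (Fin m) (Fin n) 𝕜) :
    Matrix (Fin (P * m)) (Fin n) 𝕜 :=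
  Matrix.of fun r j => A (finProdFinEquiv.symm r).1 (finProdFinEquiv.symm r).2 j

section OrderedRing

variable {R : Type*} [CommRing R] [LinearOrder R] [IsStrictOrderedRing R]

theorem sub_pow_add_le_add_pow {a b : R} (ha : 0 ≤ a) (hb : 0 ≤ b) (p : ℕ) :
    (a - b) ^ p + 2 * p * a ^ (p - 1) * b ≤ (a + b) ^ p := by
  have hterm : ∀ k, 0 ≤ (b ^ k - (-b) ^ k) * a ^ (p - k) * p.choose k := fun k => by
    have hpow : (-b) ^ k ≤ b ^ k := by
      simpa only [abs_pow, abs_neg, abs_of_nonneg hb] using le_abs_self ((-b) ^ k)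
    have := sub_nonneg.2 hpow
    positivity
  have hexpand : (a + b) ^ p - (a - b) ^ p =
      ∑ k ∈ Finset.range (p + 1), (b ^ k - (-b) ^ k) * a ^ (p - k) * p.choose k := by
    rw [add_comm a b, sub_eq_neg_add a b, add_pow, add_pow, ← Finset.sum_sub_distrib]
    exact Finset.sum_congr rfl fun k _ => by ring
  rcases Nat.eq_zero_or_pos p with rfl | hp
  · simp
  · have hlinear := Finset.single_le_sum (fun k _ => hterm k)
      (Finset.mem_range.2 (Nat.succ_lt_succ hp))
    rw [← hexpand, Nat.choose_one_right] at hlinear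
    linear_combination hlinear

theorem abs_sub_pow_add_le_add_pow {a b : R} (ha : 0 ≤ a) (hb : 0 ≤ b) {p : ℕ} (hp : 2 ≤ p) :
    |a - b| ^ p + 2 * p * a ^ (p - 1) * b ≤ (a + b) ^ p := by
  rcases le_total b a with hba | hab
  · rw [abs_of_nonneg (sub_nonneg.2 hba)]
    exact sub_pow_add_le_add_pow ha hb p
  · have hswap : a ^ (p - 1) * b ≤ b ^ (p - 1) * a := by
      obtain ⟨q, rfl⟩ := Nat.exists_eq_add_of_le' hp
      calc a ^ (q + 1) * b = a ^ q * (a * b) := by ring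
        _ ≤ b ^ q * (a * b) := by gcongr
        _ = b ^ (q + 1) * a := by ring
    rw [abs_sub_comm, abs_of_nonneg (sub_nonneg.2 hab), add_comm a b]
    calc (b - a) ^ p + 2 * p * a ^ (p - 1) * b
        = (b - a) ^ p + 2 * p * (a ^ (p - 1) * b) := by ring
      _ ≤ (b - a) ^ p + 2 * p * (b ^ (p - 1) * a) := by gcongr
      _ = (b - a) ^ p + 2 * p * b ^ (p - 1) * a := by ring
      _ ≤ (b + a) ^ p := sub_pow_add_le_add_pow hb ha p

theorem add_pow_eq_add_add_sum_Icc {R : Type*} [CommSemiring R] (a b : R) {p : ℕ} (hp : 1 ≤ p) :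
    (a + b) ^ p = a ^ p + p * a ^ (p - 1) * b +
      ∑ k ∈ Finset.Icc 2 p, (p.choose k : R) * a ^ (p - k) * b ^ k := by
  rw [add_comm a b, add_pow, Finset.range_eq_Ico, Finset.sum_eq_sum_Ico_succ_bot (by omega),
    Finset.sum_eq_sum_Ico_succ_bot (by omega), ← add_assoc]
  congr 1
  · simp only [pow_zero, one_mul, Nat.sub_zero, Nat.choose_zero_right, Nat.cast_one, mul_one,
      zero_add, pow_one, Nat.choose_one_right]
    ring
  · exact Finset.sum_congr rfl fun k _ => by ring

-- Keeping the sign of `z` in the linear term is what makes that term vanish for centred `z`.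
theorem abs_add_pow_le_add_sum_Icc (s z : R) {p : ℕ} (hp : 2 ≤ p) :
    |s + z| ^ p ≤ |s| ^ p + p * (s * |s| ^ (p - 2) * z) +
      ∑ k ∈ Finset.Icc 2 p, (p.choose k : R) * |s| ^ (p - k) * |z| ^ k := by
  wlog hs : 0 ≤ s generalizing s z
  · have hneg := this (-s) (-z) (neg_nonneg.2 (le_of_not_ge hs))
    rw [← neg_add, abs_neg, abs_neg, abs_neg] at hneg
    linear_combination hneg
  have hbinomial := add_pow_eq_add_add_sum_Icc |s| |z| (one_le_two.trans hp)
  have hpow : s * s ^ (p - 2) = s ^ (p - 1) := by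
    rw [← pow_succ']
    congr 1
    omega
  rw [abs_of_nonneg hs] at hbinomial ⊢
  rw [hpow]
  rcases le_total 0 z with hz | hz
  · rw [abs_of_nonneg (add_nonneg hs hz)]
    rw [abs_of_nonneg hz] at hbinomial ⊢
    linear_combination hbinomial
  · have hsub := abs_sub_pow_add_le_add_pow hs (abs_nonneg z) hp
    rw [hbinomial, abs_of_nonpos hz, sub_neg_eq_add] at hsub
    rw [abs_of_nonpos hz]
    linear_combination hsub

end OrderedRing

section Exponential

theorem sum_Icc_two_pow_div_factorial_le {u : ℝ} (hu : 0 ≤ u) (t : ℕ) :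
    ∑ k ∈ Finset.Icc 2 t, u ^ k / k.factorial ≤ Real.exp u - 1 - u := by
  have hsub : Finset.Icc 2 t ⊆ Finset.Ico 2 (t + 2) := fun k hk => by
    simp only [Finset.mem_Icc, Finset.mem_Ico] at hk ⊢
    omega
  calc ∑ k ∈ Finset.Icc 2 t, u ^ k / k.factorial
      ≤ ∑ k ∈ Finset.Ico 2 (t + 2), u ^ k / k.factorial :=
        Finset.sum_le_sum_of_subset_of_nonneg hsub fun _ _ _ => by positivity
    _ = ∑ k ∈ Finset.range (t + 2), u ^ k / k.factorial - (1 + u) := by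
        rw [Finset.sum_Ico_eq_sub _ (by omega)]
        simp [Finset.sum_range_succ]
    _ ≤ Real.exp u - 1 - u := by
        linarith [Real.sum_le_exp_of_nonneg hu (t + 2)]

theorem exp_sub_one_sub_self_le_sq {u : ℝ} (hu : 0 ≤ u) :
    Real.exp u - 1 - u ≤ (Real.exp u - 1) ^ 2 := by
  have hlower := Real.add_one_le_exp u
  have hupper : Real.exp u - 1 ≤ u * Real.exp u := by
    have hinv : Real.exp u * Real.exp (-u) = 1 := by
      rw [← Real.exp_add, add_neg_cancel, Real.exp_zero]
    nlinarith [Real.add_one_le_exp (-u), Real.exp_pos u]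
  calc Real.exp u - 1 - u ≤ u * (Real.exp u - 1) := by linarith
    _ ≤ (Real.exp u - 1) * (Real.exp u - 1) := by gcongr <;> linarith
    _ = (Real.exp u - 1) ^ 2 := (sq _).symm

theorem natCast_pow_self_le_exp_pow_mul_factorial (k : ℕ) :
    (k : ℝ) ^ k ≤ Real.exp 1 ^ k * k.factorial := by
  have := Real.pow_div_factorial_le_exp (k : ℝ) k.cast_nonneg k
  rwa [div_le_iff₀ (by positivity), ← mul_one (k : ℝ), Real.exp_nat_mul, mul_one] at this

theorem sq_choose_mul_pow_le {u : ℝ} (hu : 0 ≤ u) (t k : ℕ) :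
    ((t.choose k : ℝ) * (√(k * u) / (4 * Real.exp 1 * t)) ^ k) ^ 2 ≤
      (1 / 2) ^ k * (u ^ k / k.factorial) := by
  have hchoose : (t.choose k : ℝ) / t ^ k ≤ 1 / k.factorial :=
    div_le_of_le_mul₀ (by positivity) (by positivity)
      ((Nat.choose_le_pow_div k t).trans_eq (by ring))
  have hexp : 2 ≤ Real.exp 1 := by linarith [Real.add_one_le_exp 1]
  have hconst : u / (16 * Real.exp 1) ≤ 1 / 2 * u := by
    rw [div_le_iff₀ (by positivity)]
    nlinarith
  calc ((t.choose k : ℝ) * (√(k * u) / (4 * Real.exp 1 * t)) ^ k) ^ 2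
      = ((t.choose k : ℝ) / t ^ k) ^ 2 * ((√(k * u) ^ 2) ^ k / ((4 * Real.exp 1) ^ 2) ^ k) := by
        rw [← pow_mul, ← pow_mul, mul_comm 2 k, pow_mul, pow_mul]
        simp only [div_pow, mul_pow]
        ring
    _ = ((t.choose k : ℝ) / t ^ k) ^ 2 * (k ^ k * u ^ k / ((4 * Real.exp 1) ^ 2) ^ k) := by
        rw [Real.sq_sqrt (by positivity), mul_pow]
    _ ≤ (1 / k.factorial) ^ 2 *
        (Real.exp 1 ^ k * k.factorial * u ^ k / ((4 * Real.exp 1) ^ 2) ^ k) := by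
        gcongr
        exact natCast_pow_self_le_exp_pow_mul_factorial k
    _ = (u / (16 * Real.exp 1)) ^ k / k.factorial := by
        have hconst_sq : (4 * Real.exp 1) ^ 2 = Real.exp 1 * (16 * Real.exp 1) := by ring
        rw [hconst_sq, mul_pow (Real.exp 1), div_pow u]
        field_simp
    _ ≤ (1 / 2 * u) ^ k / k.factorial := by gcongr
    _ = (1 / 2) ^ k * (u ^ k / k.factorial) := by rw [mul_pow, mul_div_assoc]

theorem sum_choose_mul_pow_le_exp_sub_one {u : ℝ} (hu : 0 ≤ u) (t : ℕ) :
    ∑ k ∈ Finset.Icc 2 t, (t.choose k : ℝ) * (√(k * u) / (4 * Real.exp 1 * t)) ^ k ≤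
      Real.exp u - 1 := by
  have hcauchySchwarz := Finset.sum_sq_le_sum_mul_sum_of_sq_le_mul (Finset.Icc 2 t)
    (fun k _ => by positivity) (fun k _ => by positivity) fun k _ => sq_choose_mul_pow_le hu t k
  have hgeom : ∑ k ∈ Finset.Icc 2 t, (1 / 2 : ℝ) ^ k ≤ 1 :=
    (geom_sum_Ico_le_of_lt_one (m := 2) (n := t + 1) (by norm_num) (by norm_num)).trans
      (by norm_num)
  refine le_of_sq_le_sq ?_ (by linarith [Real.add_one_le_exp u])
  calc _ ≤ (∑ k ∈ Finset.Icc 2 t, (1 / 2 : ℝ) ^ k) *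
        ∑ k ∈ Finset.Icc 2 t, u ^ k / k.factorial := hcauchySchwarz
    _ ≤ ∑ k ∈ Finset.Icc 2 t, u ^ k / k.factorial :=
        mul_le_of_le_one_left (Finset.sum_nonneg fun _ _ => by positivity) hgeom
    _ ≤ Real.exp u - 1 - u := sum_Icc_two_pow_div_factorial_le hu t
    _ ≤ (Real.exp u - 1) ^ 2 := exp_sub_one_sub_self_le_sq hu

end Exponential

section Moments

variable {α : Type*} [MeasurableSpace α] {μ : Measure α}

theorem eLpNorm_natCast_le_ofReal_iff {E : Type*} [NormedAddCommGroup E] {f : α → E} {k : ℕ}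
    (hk : k ≠ 0) (hf : MemLp f k μ) {c : ℝ} (hc : 0 ≤ c) :
    eLpNorm f k μ ≤ ENNReal.ofReal c ↔ ∫ a, ‖f a‖ ^ k ∂μ ≤ c ^ k := by
  have hI : 0 ≤ ∫ a, ‖f a‖ ^ k ∂μ := integral_nonneg fun a => by positivity
  rw [hf.eLpNorm_eq_integral_rpow_norm (by exact_mod_cast hk) (ENNReal.natCast_ne_top k),
    ENNReal.ofReal_le_ofReal_iff hc]
  simp only [ENNReal.toReal_natCast, Real.rpow_natCast]
  rw [Real.rpow_inv_le_iff_of_pos hI hc (by positivity), Real.rpow_natCast]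

theorem integral_norm_pow_le_of_le [IsProbabilityMeasure μ] {E : Type*} [NormedAddCommGroup E]
    {f : α → E} {j p : ℕ} (hjp : j ≤ p) (hf : MemLp f p μ) {c : ℝ} (hc : 0 ≤ c)
    (h : ∫ a, ‖f a‖ ^ p ∂μ ≤ c ^ p) : ∫ a, ‖f a‖ ^ j ∂μ ≤ c ^ j := by
  rcases eq_or_ne j 0 with rfl | hj
  · simp
  have hle : (j : ENNReal) ≤ p := by exact_mod_cast hjp
  rw [← eLpNorm_natCast_le_ofReal_iff hj (hf.mono_exponent hle) hc]
  exact (eLpNorm_le_eLpNorm_of_exponent_le hle hf.1).trans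
    ((eLpNorm_natCast_le_ofReal_iff (by omega) hf hc).2 h)

theorem integrable_norm_pow_of_le [IsFiniteMeasure μ] {E : Type*} [NormedAddCommGroup E]
    {f : α → E} {j p : ℕ} (hjp : j ≤ p) (hf : MemLp f p μ) :
    Integrable (fun a => ‖f a‖ ^ j) μ :=
  (hf.mono_exponent (by exact_mod_cast hjp)).integrable_norm_pow'

theorem integrable_mul_abs_pow [IsFiniteMeasure μ] {f : α → ℝ} {j p : ℕ} (hjp : j + 1 ≤ p)
    (hf : MemLp f p μ) : Integrable (fun a => f a * |f a| ^ j) μ := by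
  have hmeas : AEStronglyMeasurable (fun a => f a * |f a| ^ j) μ := hf.1.mul (hf.1.norm.pow j)
  refine (integrable_norm_pow_of_le hjp hf).mono' hmeas (ae_of_all _ fun a => ?_)
  rw [norm_mul, norm_pow, Real.norm_eq_abs, Real.norm_eq_abs, abs_abs, pow_succ']

/-- The factor by which an independent summand `Z` with mean zero can raise a bound `R ^ p` on a
`p`-th moment. It is `E[(1 + |Z| / R) ^ p]` with the first-order term removed from the binomial
expansion, since that term vanishes for a summand of mean zero. -/
noncomputable def momentFactor (Z : α → ℝ) (μ : Measure α) (p : ℕ) (R : ℝ) : ℝ :=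
  1 + ∑ k ∈ Finset.Icc 2 p, (p.choose k : ℝ) * ((∫ a, |Z a| ^ k ∂μ) / R ^ k)

theorem one_le_momentFactor (Z : α → ℝ) (p : ℕ) {R : ℝ} (hR : 0 ≤ R) :
    1 ≤ momentFactor Z μ p R :=
  le_add_of_nonneg_right (Finset.sum_nonneg fun k _ => by positivity)

theorem momentFactor_anti (Z : α → ℝ) (p : ℕ) {R Q : ℝ} (hR : 0 < R) (hRQ : R ≤ Q) :
    momentFactor Z μ p Q ≤ momentFactor Z μ p R := by
  unfold momentFactor
  gcongr

theorem momentFactor_le_exp {Z : α → ℝ} {t : ℕ} {K N : ℝ} (hK : 0 < K) (hN : 0 < N)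
    (hZ : ∀ k ∈ Finset.Icc 2 t, ∫ a, |Z a| ^ k ∂μ ≤ (K * √k) ^ k) :
    momentFactor Z μ t (4 * Real.exp 1 * K * √(N * t)) ≤ Real.exp (t / N) := by
  have hratio : ∀ k : ℕ, K * √k / (4 * Real.exp 1 * K * √(N * t)) =
      √(k * (t / N)) / (4 * Real.exp 1 * t) := fun k => by
    rw [Real.sqrt_mul hN.le, Real.sqrt_mul k.cast_nonneg, Real.sqrt_div t.cast_nonneg]
    rcases Nat.eq_zero_or_pos t with rfl | ht
    · simp
    have hts : √(t : ℝ) ^ 2 = t := Real.sq_sqrt t.cast_nonneg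
    field_simp
    rw [hts]
  have hsum : ∑ k ∈ Finset.Icc 2 t, (t.choose k : ℝ) *
      ((∫ a, |Z a| ^ k ∂μ) / (4 * Real.exp 1 * K * √(N * t)) ^ k) ≤ Real.exp (t / N) - 1 :=
    calc _ ≤ ∑ k ∈ Finset.Icc 2 t, (t.choose k : ℝ) *
          ((K * √k) ^ k / (4 * Real.exp 1 * K * √(N * t)) ^ k) := by
          gcongr with k hk
          exact hZ k hk
      _ = ∑ k ∈ Finset.Icc 2 t, (t.choose k : ℝ) *
          (√(k * (t / N)) / (4 * Real.exp 1 * t)) ^ k := by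
          simp only [← div_pow, hratio]
      _ ≤ Real.exp (t / N) - 1 := sum_choose_mul_pow_le_exp_sub_one (by positivity) t
  unfold momentFactor
  linarith

theorem indepFun_abs_pow {S Z : α → ℝ} (hSZ : IndepFun S Z μ) (j k : ℕ) :
    IndepFun (fun a => |S a| ^ j) (fun a => |Z a| ^ k) μ :=
  hSZ.comp (φ := fun x => |x| ^ j) (ψ := fun x => |x| ^ k) (by fun_prop) (by fun_prop)

theorem indepFun_mul_abs_pow {S Z : α → ℝ} (hSZ : IndepFun S Z μ) (j : ℕ) :
    IndepFun (fun a => S a * |S a| ^ j) Z μ :=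
  hSZ.comp (φ := fun x => x * |x| ^ j) (by fun_prop) measurable_id

theorem integral_mul_abs_pow_mul_eq_zero {S Z : α → ℝ} (hSZ : IndepFun S Z μ)
    (hS : AEStronglyMeasurable S μ) (hZ : AEStronglyMeasurable Z μ) (hZ0 : ∫ a, Z a ∂μ = 0)
    (j : ℕ) : ∫ a, S a * |S a| ^ j * Z a ∂μ = 0 := by
  rw [(indepFun_mul_abs_pow hSZ j).integral_fun_mul_eq_mul_integral (hS.mul (hS.norm.pow j)) hZ,
    hZ0, mul_zero]

theorem integral_abs_add_pow_le_add_sum [IsProbabilityMeasure μ] {S Z : α → ℝ}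
    (hSZ : IndepFun S Z μ) {p : ℕ} (hp : 2 ≤ p) (hS : MemLp S p μ) (hZ : MemLp Z p μ)
    (hZ0 : ∫ a, Z a ∂μ = 0) :
    ∫ a, |S a + Z a| ^ p ∂μ ≤ ∫ a, |S a| ^ p ∂μ + ∑ k ∈ Finset.Icc 2 p,
      (p.choose k : ℝ) * ((∫ a, |S a| ^ (p - k) ∂μ) * ∫ a, |Z a| ^ k ∂μ) := by
  have hSj : ∀ j ≤ p, Integrable (fun a => |S a| ^ j) μ := fun j hj =>
    integrable_norm_pow_of_le hj hS
  have hZj : ∀ j ≤ p, Integrable (fun a => |Z a| ^ j) μ := fun j hj =>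
    integrable_norm_pow_of_le hj hZ
  have hlinear : Integrable (fun a => p * (S a * |S a| ^ (p - 2) * Z a)) μ :=
    ((indepFun_mul_abs_pow hSZ _).integrable_mul (integrable_mul_abs_pow (by omega) hS)
      (hZ.integrable (by exact_mod_cast one_le_two.trans hp))).const_mul _
  have hterm : ∀ k ∈ Finset.Icc 2 p,
      Integrable (fun a => (p.choose k : ℝ) * |S a| ^ (p - k) * |Z a| ^ k) μ := fun k hk => by
    simpa only [mul_assoc, Pi.mul_apply] using ((indepFun_abs_pow hSZ _ _).integrable_mul
      (hSj _ (Nat.sub_le _ _)) (hZj _ (Finset.mem_Icc.1 hk).2)).const_mul (p.choose k : ℝ)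
  have hlow : Integrable (fun a => |S a| ^ p + p * (S a * |S a| ^ (p - 2) * Z a)) μ :=
    (hSj p le_rfl).add hlinear
  have hsum := integrable_finsetSum _ hterm
  calc ∫ a, |S a + Z a| ^ p ∂μ
      ≤ ∫ a, (|S a| ^ p + p * (S a * |S a| ^ (p - 2) * Z a) +
        ∑ k ∈ Finset.Icc 2 p, (p.choose k : ℝ) * |S a| ^ (p - k) * |Z a| ^ k) ∂μ :=
        integral_mono (integrable_norm_pow_of_le le_rfl (hS.add hZ)) (hlow.add hsum)
          fun a => abs_add_pow_le_add_sum_Icc _ _ hp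
    _ = ∫ a, |S a| ^ p ∂μ + ∑ k ∈ Finset.Icc 2 p,
        ∫ a, (p.choose k : ℝ) * |S a| ^ (p - k) * |Z a| ^ k ∂μ := by
        rw [integral_add hlow hsum, integral_add (hSj p le_rfl) hlinear, integral_const_mul,
          integral_mul_abs_pow_mul_eq_zero hSZ hS.1 hZ.1 hZ0, mul_zero, add_zero,
          integral_finsetSum _ hterm]
    _ = _ := by
        congr 1
        refine Finset.sum_congr rfl fun k hk => ?_
        simp only [mul_assoc]
        rw [integral_const_mul, (indepFun_abs_pow hSZ _ _).integral_fun_mul_eq_mul_integral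
          (hSj _ (Nat.sub_le _ _)).1 (hZj _ (Finset.mem_Icc.1 hk).2).1]

theorem integral_abs_add_pow_le_mul_momentFactor [IsProbabilityMeasure μ] {S Z : α → ℝ}
    (hSZ : IndepFun S Z μ) {p : ℕ} (hp : 2 ≤ p) (hS : MemLp S p μ) (hZ : MemLp Z p μ)
    (hZ0 : ∫ a, Z a ∂μ = 0) {Q : ℝ} (hQ : 0 < Q) (hSQ : ∫ a, |S a| ^ p ∂μ ≤ Q ^ p) :
    ∫ a, |S a + Z a| ^ p ∂μ ≤ Q ^ p * momentFactor Z μ p Q := by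
  refine (integral_abs_add_pow_le_add_sum hSZ hp hS hZ hZ0).trans ?_
  rw [momentFactor, mul_add, mul_one, Finset.mul_sum]
  refine add_le_add hSQ (Finset.sum_le_sum fun k hk => ?_)
  have hQk : Q ^ p = Q ^ (p - k) * Q ^ k := by
    rw [← pow_add, Nat.sub_add_cancel (Finset.mem_Icc.1 hk).2]
  calc (p.choose k : ℝ) * ((∫ a, |S a| ^ (p - k) ∂μ) * ∫ a, |Z a| ^ k ∂μ)
      ≤ (p.choose k : ℝ) * (Q ^ (p - k) * ∫ a, |Z a| ^ k ∂μ) := by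
        gcongr
        exact integral_norm_pow_le_of_le (Nat.sub_le _ _) hS hQ.le hSQ
    _ = Q ^ p * ((p.choose k : ℝ) * ((∫ a, |Z a| ^ k ∂μ) / Q ^ k)) := by
        rw [hQk]
        field_simp

variable {ι : Type*} {Z : ι → α → ℝ}

theorem integral_abs_sum_pow_le_prod_momentFactor (hZ : iIndepFun Z μ) {p : ℕ} (hp : 2 ≤ p)
    (hLp : ∀ i, MemLp (Z i) p μ) (hZ0 : ∀ i, ∫ a, Z i a ∂μ = 0) {R : ℝ} (hR : 0 < R)
    (s : Finset ι) :
    ∫ a, |∑ i ∈ s, Z i a| ^ p ∂μ ≤ R ^ p * ∏ i ∈ s, momentFactor (Z i) μ p R := by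
  classical
  have := hZ.isProbabilityMeasure
  have hp0 : p ≠ 0 := by omega
  induction s using Finset.induction_on with
  | empty => simpa [hp0] using pow_nonneg hR.le p
  | insert i s hi ih =>
    have hprod : 1 ≤ ∏ j ∈ s, momentFactor (Z j) μ p R :=
      Finset.one_le_prod fun j _ => one_le_momentFactor (Z j) p hR.le
    obtain ⟨Q, hRQ, hQ⟩ : ∃ Q, R ≤ Q ∧ Q ^ p = R ^ p * ∏ j ∈ s, momentFactor (Z j) μ p R := by
      refine ⟨R * (∏ j ∈ s, momentFactor (Z j) μ p R) ^ (p : ℝ)⁻¹,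
        le_mul_of_one_le_right hR.le (Real.one_le_rpow hprod (by positivity)), ?_⟩
      rw [mul_pow, Real.rpow_inv_natCast_pow (by positivity) hp0]
    have hind : IndepFun (fun a => ∑ j ∈ s, Z j a) (Z i) μ := by
      simpa only [← Finset.sum_apply] using
        hZ.indepFun_finsetSum_of_notMem₀ (fun j => (hLp j).1.aemeasurable) hi
    simp only [Finset.sum_insert hi, Finset.prod_insert hi, add_comm (Z i _)]
    calc ∫ a, |∑ j ∈ s, Z j a + Z i a| ^ p ∂μ
        ≤ Q ^ p * momentFactor (Z i) μ p Q :=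
          integral_abs_add_pow_le_mul_momentFactor hind hp (memLp_finsetSum s fun j _ => hLp j)
            (hLp i) (hZ0 i) (hR.trans_le hRQ) (hQ ▸ ih)
      _ ≤ Q ^ p * momentFactor (Z i) μ p R := by
          gcongr
          · exact pow_nonneg (hR.le.trans hRQ) p
          · exact momentFactor_anti (Z i) p hR hRQ
      _ = R ^ p * (momentFactor (Z i) μ p R * ∏ j ∈ s, momentFactor (Z j) μ p R) := by
          rw [hQ]
          ring

theorem eLpNorm_sum_le_of_eLpNorm_le_mul_sqrt [Fintype ι] [Nonempty ι] (hZ : iIndepFun Z μ)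
    {t : ℕ} (ht : 2 ≤ t) (hm : ∀ i, AEStronglyMeasurable (Z i) μ) (hZ0 : ∀ i, ∫ a, Z i a ∂μ = 0)
    {K : ℝ} (hK : 0 < K)
    (hb : ∀ i, ∀ k ∈ Finset.Icc 2 t, eLpNorm (Z i) k μ ≤ ENNReal.ofReal (K * √k)) :
    eLpNorm (fun a => ∑ i, Z i a) t μ ≤
      ENNReal.ofReal (4 * Real.exp 1 ^ 2 * K * √(Fintype.card ι * t)) := by
  have hN : (0 : ℝ) < Fintype.card ι := Nat.cast_pos.2 Fintype.card_pos
  set R := 4 * Real.exp 1 * K * √(Fintype.card ι * t) with hR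
  have hR0 : 0 < R := by positivity
  have hLp : ∀ i, ∀ k ∈ Finset.Icc 2 t, MemLp (Z i) k μ := fun i k hk =>
    ⟨hm i, (hb i k hk).trans_lt ENNReal.ofReal_lt_top⟩
  have hLt : ∀ i, MemLp (Z i) t μ := fun i => hLp i t (Finset.mem_Icc.2 ⟨ht, le_rfl⟩)
  have hmoment : ∀ i, ∀ k ∈ Finset.Icc 2 t, ∫ a, |Z i a| ^ k ∂μ ≤ (K * √k) ^ k := fun i k hk =>
    (eLpNorm_natCast_le_ofReal_iff (by have := (Finset.mem_Icc.1 hk).1; omega) (hLp i k hk)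
      (by positivity)).1 (hb i k hk)
  have hsum : MemLp (fun a => ∑ i, Z i a) t μ := memLp_finsetSum _ fun i _ => hLt i
  rw [eLpNorm_natCast_le_ofReal_iff (by omega) hsum (by positivity)]
  calc ∫ a, |∑ i, Z i a| ^ t ∂μ
      ≤ R ^ t * ∏ i, momentFactor (Z i) μ t R :=
        integral_abs_sum_pow_le_prod_momentFactor hZ ht hLt hZ0 hR0 Finset.univ
    _ ≤ R ^ t * ∏ _i : ι, Real.exp (t / Fintype.card ι) := by
        gcongr with i
        · exact fun i _ => zero_le_one.trans (one_le_momentFactor (Z i) t hR0.le)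
        · exact momentFactor_le_exp hK hN (hmoment i)
    _ = R ^ t * Real.exp 1 ^ t := by
        rw [Finset.prod_const, Finset.card_univ, ← Real.exp_nat_mul, ← Real.exp_nat_mul,
          mul_div_cancel₀ _ hN.ne', mul_one]
    _ = (4 * Real.exp 1 ^ 2 * K * √(Fintype.card ι * t)) ^ t := by
        rw [← mul_pow, hR]
        ring

theorem eLpNorm_average_le_of_eLpNorm_le_mul_sqrt [Fintype ι] [Nonempty ι] (hZ : iIndepFun Z μ)
    {t : ℕ} (ht : 2 ≤ t) (hm : ∀ i, AEStronglyMeasurable (Z i) μ) (hZ0 : ∀ i, ∫ a, Z i a ∂μ = 0)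
    {K : ℝ} (hK : 0 < K)
    (hb : ∀ i, ∀ k ∈ Finset.Icc 2 t, eLpNorm (Z i) k μ ≤ ENNReal.ofReal (K * √k)) :
    eLpNorm (fun a => (Fintype.card ι : ℝ)⁻¹ * ∑ i, Z i a) t μ ≤
      ENNReal.ofReal (4 * Real.exp 1 ^ 2 * K * √(t / Fintype.card ι)) := by
  have hN : (0 : ℝ) < Fintype.card ι := Nat.cast_pos.2 Fintype.card_pos
  have hsqrt : (Fintype.card ι : ℝ)⁻¹ * √(Fintype.card ι * t) = √(t / Fintype.card ι) := by
    rw [Real.sqrt_mul hN.le, Real.sqrt_div t.cast_nonneg, ← mul_assoc, inv_mul_eq_div,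
      Real.sqrt_div_self', div_mul_eq_mul_div, one_mul]
  calc eLpNorm (fun a => (Fintype.card ι : ℝ)⁻¹ * ∑ i, Z i a) t μ
      = ENNReal.ofReal (Fintype.card ι : ℝ)⁻¹ * eLpNorm (fun a => ∑ i, Z i a) t μ := by
        rw [← Real.enorm_eq_ofReal (by positivity), ← eLpNorm_const_smul]
        rfl
    _ ≤ ENNReal.ofReal (Fintype.card ι : ℝ)⁻¹ *
        ENNReal.ofReal (4 * Real.exp 1 ^ 2 * K * √(Fintype.card ι * t)) := by
        gcongr
        exact eLpNorm_sum_le_of_eLpNorm_le_mul_sqrt hZ ht hm hZ0 hK hb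
    _ = ENNReal.ofReal (4 * Real.exp 1 ^ 2 * K * √(t / Fintype.card ι)) := by
        rw [← ENNReal.ofReal_mul (by positivity), ← hsqrt]
        congr 1
        ring

end Moments

section Matrices

theorem measurable_matrix_apply {𝕜 : Type*} [MeasurableSpace 𝕜] {m n : ℕ} (i : Fin m)
    (j : Fin n) : Measurable fun M : Matrix (Fin m) (Fin n) 𝕜 => M i j :=
  (measurable_pi_apply j).comp (measurable_pi_apply (X := fun _ : Fin m => Fin n → 𝕜) i)

theorem measurable_matrix_iff {𝕜 α : Type*} [MeasurableSpace 𝕜] [MeasurableSpace α] {m n : ℕ}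
    {f : α → Matrix (Fin m) (Fin n) 𝕜} : Measurable f ↔ ∀ i j, Measurable fun a => f a i j :=
  ⟨fun h i j => (measurable_matrix_apply i j).comp h, fun h =>
    measurable_pi_lambda (X := fun _ : Fin m => Fin n → 𝕜) f fun i =>
      measurable_pi_lambda _ fun j => h i j⟩

theorem measurable_vstack {𝕜 : Type*} [MeasurableSpace 𝕜] {P m n : ℕ} :
    Measurable (vstack : (Fin P → Matrix (Fin m) (Fin n) 𝕜) → Matrix (Fin (P * m)) (Fin n) 𝕜) :=
  measurable_matrix_iff.2 fun r j =>
    (measurable_matrix_apply (finProdFinEquiv.symm r).2 j).comp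
      (measurable_pi_apply (finProdFinEquiv.symm r).1)

theorem measurable_const_smul_matrix {S 𝕜 : Type*} [MeasurableSpace 𝕜] [SMul S 𝕜]
    [MeasurableConstSMul S 𝕜] {m n : ℕ} (c : S) :
    Measurable fun M : Matrix (Fin m) (Fin n) 𝕜 => c • M :=
  measurable_matrix_iff.2 fun i j => (measurable_matrix_apply i j).const_smul c

variable {𝕜 : Type*} [RCLike 𝕜] {P m n : ℕ}

theorem norm_toLp_vstack_mulVec_sq (A : Fin P → Matrix (Fin m) (Fin n) 𝕜) (x : Fin n → 𝕜) :
    ‖WithLp.toLp 2 (vstack A *ᵥ x)‖ ^ 2 = ∑ i, ‖WithLp.toLp 2 (A i *ᵥ x)‖ ^ 2 := by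
  simp only [EuclideanSpace.norm_sq_eq]
  rw [← Fintype.sum_prod_type', ← finProdFinEquiv.symm.sum_comp]
  rfl

theorem norm_toLp_smul_vstack_mulVec_sq (A : Fin P → Matrix (Fin m) (Fin n) 𝕜) (x : Fin n → 𝕜) :
    ‖WithLp.toLp 2 ((((1 / √P : ℝ) : 𝕜) • vstack A) *ᵥ x)‖ ^ 2 =
      (P : ℝ)⁻¹ * ∑ i, ‖WithLp.toLp 2 (A i *ᵥ x)‖ ^ 2 := by
  rw [Matrix.smul_mulVec, WithLp.toLp_smul, norm_smul, mul_pow, RCLike.norm_ofReal, sq_abs,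
    div_pow, Real.sq_sqrt P.cast_nonneg, one_pow, one_div, norm_toLp_vstack_mulVec_sq]

/-- The distortion `‖M x‖₂² - 1` of the squared length of the unit vector `x` under the matrix `M`,
whose moments the Strong JLM property controls. -/
noncomputable def distortion (x : EuclideanSpace 𝕜 (Fin n)) (M : Matrix (Fin m) (Fin n) 𝕜) : ℝ :=
  ‖WithLp.toLp 2 (M *ᵥ x.ofLp)‖ ^ 2 - 1

theorem measurable_distortion (x : EuclideanSpace 𝕜 (Fin n)) :
    Measurable (distortion x : Matrix (Fin m) (Fin n) 𝕜 → ℝ) := by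
  unfold distortion
  simp only [EuclideanSpace.norm_sq_eq, Matrix.mulVec, dotProduct]
  fun_prop

theorem distortion_smul_vstack (hP : 1 ≤ P) (A : Fin P → Matrix (Fin m) (Fin n) 𝕜)
    (x : EuclideanSpace 𝕜 (Fin n)) :
    distortion x (((1 / √P : ℝ) : 𝕜) • vstack A) = (P : ℝ)⁻¹ * ∑ i, distortion x (A i) := by
  have hP0 : (P : ℝ) ≠ 0 := by positivity
  simp only [distortion, norm_toLp_smul_vstack_mulVec_sq, Finset.sum_sub_distrib,
    Finset.sum_const, Finset.card_univ, Fintype.card_fin, nsmul_eq_mul, mul_one, mul_sub,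
    inv_mul_cancel₀ hP0]

end Matrices

namespace StrongJLM

variable {𝕜 : Type*} [RCLike 𝕜] {m n : ℕ} {Ω Ω' : Type*} [MeasurableSpace Ω] [MeasurableSpace Ω']
  {μ : Measure Ω} {ν : Measure Ω'} {A : Ω → Matrix (Fin m) (Fin n) 𝕜}
  {B : Ω' → Matrix (Fin m) (Fin n) 𝕜} {ε δ : ℝ} {x : EuclideanSpace 𝕜 (Fin n)}

theorem of_identDistrib (hB : StrongJLM B ν ε δ) (h : IdentDistrib A B μ ν) :
    StrongJLM A μ ε δ where
  aemeasurable := h.aemeasurable_fst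
  moment x hx t ht htL :=
    ((h.comp (measurable_distortion x)).eLpNorm_eq t).trans_le (hB.moment x hx t ht htL)
  expectation x hx := by
    have hsq : Measurable fun M : Matrix (Fin m) (Fin n) 𝕜 =>
        ‖WithLp.toLp 2 (M *ᵥ x.ofLp)‖ ^ 2 := by
      simpa only [distortion, sub_add_cancel] using (measurable_distortion x).add_const 1
    exact (h.comp hsq).integral_eq.trans (hB.expectation x hx)

theorem aestronglyMeasurable_distortion (hA : StrongJLM A μ ε δ) (x : EuclideanSpace 𝕜 (Fin n)) :
    AEStronglyMeasurable (fun ω => distortion x (A ω)) μ :=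
  ((measurable_distortion x).comp_aemeasurable hA.aemeasurable).aestronglyMeasurable

-- The Bochner integral of a non-integrable function is `0`, so the value `1` forces integrability.
theorem integrable_norm_sq (hA : StrongJLM A μ ε δ) (hx : ‖x‖ = 1) :
    Integrable (fun ω => ‖WithLp.toLp 2 (A ω *ᵥ x.ofLp)‖ ^ 2) μ :=
  not_imp_comm.1 integral_undef (by rw [hA.expectation x hx]; exact one_ne_zero)

theorem integral_distortion [IsProbabilityMeasure μ] (hA : StrongJLM A μ ε δ) (hx : ‖x‖ = 1) :
    ∫ ω, distortion x (A ω) ∂μ = 0 := by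
  simp only [distortion]
  rw [integral_sub (hA.integrable_norm_sq hx) (integrable_const 1), hA.expectation x hx]
  simp

theorem eLpNorm_distortion_le (hA : StrongJLM A μ ε δ) (hx : ‖x‖ = 1) {t : ℕ} (ht : 2 ≤ t)
    (htL : t ≤ Real.log (1 / δ)) :
    eLpNorm (fun ω => distortion x (A ω)) t μ ≤
      ENNReal.ofReal (ε / (Real.exp 1 * √(Real.log (1 / δ))) * √t) := by
  refine (hA.moment x hx t ht htL).trans_eq (congrArg ENNReal.ofReal ?_)
  rw [Real.sqrt_div t.cast_nonneg]
  ring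

end StrongJLM

section Stacking

variable {𝕜 : Type*} [RCLike 𝕜] {P m n : ℕ} {Ω : Type*} [MeasurableSpace Ω] {μ : Measure Ω}
  {A : Fin P → Ω → Matrix (Fin m) (Fin n) 𝕜} {ε δ : ℝ} {x : EuclideanSpace 𝕜 (Fin n)}

theorem aemeasurable_smul_vstack (c : 𝕜) (hA : ∀ i, AEMeasurable (A i) μ) :
    AEMeasurable (fun ω => c • vstack fun i => A i ω) μ :=
  ((measurable_const_smul_matrix c).comp measurable_vstack).comp_aemeasurable
    (aemeasurable_pi_lambda _ hA)

theorem integral_norm_sq_smul_vstack (hP : 1 ≤ P) (hA : ∀ i, StrongJLM (A i) μ ε δ)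
    (hx : ‖x‖ = 1) :
    ∫ ω, ‖WithLp.toLp 2 ((((1 / √P : ℝ) : 𝕜) • vstack fun i => A i ω) *ᵥ x.ofLp)‖ ^ 2 ∂μ
      = 1 := by
  have hP0 : (P : ℝ) ≠ 0 := by positivity
  simp_rw [norm_toLp_smul_vstack_mulVec_sq]
  rw [integral_const_mul, integral_finsetSum _ fun i _ => (hA i).integrable_norm_sq hx]
  simp [(hA _).expectation x hx, hP0]

theorem eLpNorm_distortion_smul_vstack_le (hP : 1 ≤ P) (hε : 0 < ε) (hA_indep : iIndepFun A μ)
    (hA : ∀ i, StrongJLM (A i) μ ε δ) (hx : ‖x‖ = 1) {t : ℕ} (ht : 2 ≤ t)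
    (htL : t ≤ Real.log (1 / δ)) :
    eLpNorm (fun ω => distortion x (((1 / √P : ℝ) : 𝕜) • vstack fun i => A i ω)) t μ ≤
      ENNReal.ofReal (4 * Real.exp 1 ^ 2 * (ε / (Real.exp 1 * √(Real.log (1 / δ)))) *
        √(t / P)) := by
  have := hA_indep.isProbabilityMeasure
  have : Nonempty (Fin P) := ⟨⟨0, hP⟩⟩
  have hL : 0 < Real.log (1 / δ) := lt_of_lt_of_le (by positivity) htL
  simpa only [distortion_smul_vstack hP, Fintype.card_fin, Function.comp_apply] using
    eLpNorm_average_le_of_eLpNorm_le_mul_sqrt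
      (hA_indep.comp (fun _ => distortion x) fun _ => measurable_distortion x) ht
      (fun i => (hA i).aestronglyMeasurable_distortion x)
      (fun i => (hA i).integral_distortion hx) (by positivity)
      fun i k hk => (hA i).eLpNorm_distortion_le hx (Finset.mem_Icc.1 hk).1
        ((Nat.cast_le.2 (Finset.mem_Icc.1 hk).2).trans htL)

end Stacking

theorem mainTheorem9_general {𝕜 : Type*} [RCLike 𝕜] {P m n : ℕ} (hP : 1 ≤ P)
    {Ω : Type*} [MeasurableSpace Ω] (μ : Measure Ω) (ε δ : ℝ) (hε : 0 < ε) (_hδ : 0 < δ)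
    (A : Fin P → Ω → Matrix (Fin m) (Fin n) 𝕜) (hA_indep : iIndepFun A μ)
    (hA : ∀ i, StrongJLM (A i) μ (√P * ε / (4 * Real.exp 1 ^ 2)) δ) :
    StrongJLM (fun ω => ((1 / √P : ℝ) : 𝕜) • vstack (fun i => A i ω)) μ ε δ where
  aemeasurable := aemeasurable_smul_vstack _ fun i => (hA i).aemeasurable
  moment x hx t ht htL := by
    refine (eLpNorm_distortion_smul_vstack_le hP (by positivity) hA_indep hA hx ht htL).trans_eq
      (congrArg ENNReal.ofReal ?_)
    rw [Real.sqrt_div t.cast_nonneg, Real.sqrt_div t.cast_nonneg]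
    field_simp
  expectation _ hx := integral_norm_sq_smul_vstack hP hA hx

theorem mainTheorem9 {𝕜 : Type*} [RCLike 𝕜] {P m n : ℕ} (hP : 1 ≤ P)
    {Ω Ω₀ : Type*} [MeasurableSpace Ω] [MeasurableSpace Ω₀]
    (μ : Measure Ω) [IsProbabilityMeasure μ] (ν : Measure Ω₀) [IsProbabilityMeasure ν]
    (ε δ : ℝ) (hε : 0 < ε) (hδ : 0 < δ)
    (B : Ω₀ → Matrix (Fin m) (Fin n) 𝕜)
    (hB : StrongJLM B ν (Real.sqrt P * ε / (4 * Real.exp 1 ^ 2)) δ)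
    (A : Fin P → Ω → Matrix (Fin m) (Fin n) 𝕜)
    (hA_indep : iIndepFun A μ)
    (hA_distrib : ∀ i, IdentDistrib (A i) B μ ν) :
    StrongJLM (fun ω => ((1 / Real.sqrt P : ℝ) : 𝕜) • vstack (fun i => A i ω)) μ ε δ :=
  mainTheorem9_general hP μ ε δ hε hδ A hA_indep fun i => hB.of_identDistrib (hA_distrib i)
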